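/- Let $\mathcal X$ be a measurable space, $a\le 0<b$ real numbers, $z=\max\{|a|,|b|\}$, and let $\mathcal F$ be a nonempty class of measurable functions $f:\mathcal X\to[a,b]$. Let $m\ge 1$ and let $\mathcal S=(s_1,\dots,s_m)$ be i.i.d. random elements of $\mathcal X$ with law $\mu$. Define the wimpy variance and the empirical wimpy variance by $$\sigma^2_{\mathcal F}=\sup_{f\in\mathcal F}\mathbb E_{\mu}[f^2],\qquad \hat\sigma^2_{\mathcal F}(\mathcal S)=\frac1m\sup_{f\in\mathcal F}\sum_{i=1}^m f(s_i)^2,$$ and assume that $\hat\sigma^2_{\mathcal F}(\mathcal S)$ is a random variable (measurable up to null sets). Let $h(x)=(1+x)\ln(1+x)-x$ for $x\ge-1$ (with $0\ln 0=0$). A function $g:\mathcal X^m\to[0,\infty)$ is called $(\alpha,\beta)$-self-bounding if there are functions $g_i:\mathcal X^{m-1}\to\mathbb R$, $1\le i\le m$, such that for every $x\in\mathcal X^m$, writing $x^{(i)}$ for $x$ with its $i$-th component dropped, $0\le g(x)-g_i(x^{(i)})\le 1$ for all $i$ and $\sum_{i=1}^m\bigl(g(x)-g_i(x^{(i)})\bigr)\le\alpha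 g(x)+\beta$. Then: 1. the function $\mathcal S\mapsto m\,\hat\sigma^2_{\mathcal F}(\mathcal S)/z^2$ on $\mathcal X^m$ is $(1,0)$-self-bounding; 2. $\hat\sigma^2_{\mathcal F}(\mathcal S)$ is integrable and $\sigma^2_{\mathcal F}\le\mathbb E_{\mathcal S}[\hat\sigma^2_{\mathcal F}(\mathcal S)]$; 3. if $\sigma^2_{\mathcal F}>0$, then for every $0\le\varepsilon\le\sigma^2_{\mathcal F}$, $$\Pr\left(\sigma^2_{\mathcal F}\ge\hat\sigma^2_{\mathcal F}(\mathcal S)+\varepsilon\right)\le\exp\left(-\frac{m\sigma^2_{\mathcal F}}{z^2}\,h\left(-\frac{\varepsilon}{\sigma^2_{\mathcal F}}\right)\right)\le\exp\left(-\frac{m\varepsilon^2}{2z^2\sigma^2_{\mathcal F}}\right);$$ 4. for every $\delta\in(0,1]$, with probability at least $1-\delta$, $$\sigma^2_{\mathcal F}\le\hat\sigma^2_{\mathcal F}(\mathcal S)+\frac{z^2\ln(1/\delta)}{m}+\sqrt{\left(\frac{z^2\ln(1/\delta)}{m}\right)^2+\frac{2z^2\,\hat\sigma^2_{\mathcal F}(\mathcal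 S)\ln(1/\delta)}{m}}.$$ -/

import Mathlib

open MeasureTheory ProbabilityTheory

noncomputable section

/-- The wimpy variance `sup_{f ∈ F} E[f(X)^2]`, where `X` has law `μ`. -/
def wimpyVariance {𝓧 : Type*} [MeasurableSpace 𝓧] (F : Set (𝓧 → ℝ)) (μ : Measure 𝓧) : ℝ :=
  ⨆ f : F, ∫ x, (f : 𝓧 → ℝ) x ^ 2 ∂μ

/-- The empirical wimpy variance `(1/m) sup_{f ∈ F} ∑_i f(s_i)^2` of a sample `s` of size `m`. -/
def empWimpyVariance {𝓧 : Type*} (F : Set (𝓧 → ℝ)) {m : ℕ} (s : Fin m → 𝓧) : ℝ :=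
  (1 / (m : ℝ)) * ⨆ f : F, ∑ i, (f : 𝓧 → ℝ) (s i) ^ 2

/-- `g : 𝓧ⁿ → ℝ` is a non-negative (strongly) `(α, β)`-self-bounding function: there are functions
`gᵢ` of the remaining `n - 1` coordinates (those with an index different from `i`) such that
`0 ≤ g(x) - gᵢ(x⁽ⁱ⁾) ≤ 1` and `∑ᵢ (g(x) - gᵢ(x⁽ⁱ⁾)) ≤ α g(x) + β` for every `x`. -/
def IsSelfBounding {𝓧 : Type*} {n : ℕ} (α β : ℝ) (g : (Fin n → 𝓧) → ℝ) : Prop :=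
  (∀ x, 0 ≤ g x) ∧
  ∃ g' : (i : Fin n) → ({j : Fin n // j ≠ i} → 𝓧) → ℝ,
    ∀ x : Fin n → 𝓧,
      (∀ i, 0 ≤ g x - g' i (fun j => x j) ∧ g x - g' i (fun j => x j) ≤ 1) ∧
      ∑ i, (g x - g' i (fun j => x j)) ≤ α * g x + β

/-- The function `h(x) = (1 + x) log (1 + x) - x`, used for `x ≥ -1`, with `0 log 0 = 0`. -/
def bennettH (x : ℝ) : ℝ := (1 + x) * Real.log (1 + x) - x

end

/-!
The concentration bound for a supremum does not need the self-bounding property: for every fixed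
`f ∈ F` the supremum dominates `∑ i, f (s i) ^ 2`, so a lower deviation of the supremum forces a
lower deviation of this sum of independent variables. After division by `z ^ 2` the summands lie
in `[0, 1]`, and convexity of the exponential bounds their moment generating functions by those of
Poisson variables with the same means. The Chernoff bound obtained this way depends on `f` only
through `𝔼 f ^ 2`, continuously and monotonically, so one may pass to the supremum over `f`;
optimizing the exponent then produces Bennett's function `h`. The confidence bound inverts the
quadratic lower estimate of `h`.
-/

section Chernoff

variable {Ω ι : Type*} [MeasurableSpace Ω] {P : Measure Ω} [IsProbabilityMeasure P]

lemma exp_mul_le_one_add_mul {x : ℝ} (hx : x ∈ Set.Icc (0 : ℝ) 1) (t : ℝ) :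
    Real.exp (t * x) ≤ 1 + x * (Real.exp t - 1) := by
  have chord := convexOn_exp.2 (Set.mem_univ 0) (Set.mem_univ t) (sub_nonneg.2 hx.2) hx.1 (by ring)
  simp only [smul_eq_mul, mul_zero, zero_add, Real.exp_zero] at chord
  rw [mul_comm x t] at chord
  linarith

lemma mgf_le_exp_integral_mul {X : Ω → ℝ} (hX : AEMeasurable X P)
    (h01 : ∀ᵐ ω ∂P, X ω ∈ Set.Icc (0 : ℝ) 1) (t : ℝ) :
    mgf X P t ≤ Real.exp ((∫ ω, X ω ∂P) * (Real.exp t - 1)) := by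
  have hint : Integrable (fun ω => X ω * (Real.exp t - 1)) P :=
    (Integrable.of_mem_Icc 0 1 hX h01).mul_const _
  calc mgf X P t ≤ ∫ ω, (1 + X ω * (Real.exp t - 1)) ∂P :=
        integral_mono_ae (integrable_exp_mul_of_mem_Icc hX h01) ((integrable_const 1).add hint)
          (h01.mono fun ω hω => exp_mul_le_one_add_mul hω t)
    _ = (∫ ω, X ω ∂P) * (Real.exp t - 1) + 1 := by
        rw [integral_add (integrable_const 1) hint, integral_mul_const, integral_const,
          probReal_univ, one_smul, add_comm]
    _ ≤ Real.exp ((∫ ω, X ω ∂P) * (Real.exp t - 1)) := Real.add_one_le_exp _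

lemma measureReal_sum_le_le_exp {X : ι → Ω → ℝ} (hX : ∀ i, AEMeasurable (X i) P)
    (h01 : ∀ i, ∀ᵐ ω ∂P, X i ω ∈ Set.Icc (0 : ℝ) 1) (hind : iIndepFun X P) (s : Finset ι)
    (c : ℝ) {l : ℝ} (hl : 0 ≤ l) :
    P.real {ω | ∑ i ∈ s, X i ω ≤ c} ≤
      Real.exp (l * c + (∑ i ∈ s, ∫ ω, X i ω ∂P) * (Real.exp (-l) - 1)) := by
  have hsum : ∀ᵐ ω ∂P, (∑ i ∈ s, X i) ω ∈ Set.Icc (∑ _i ∈ s, (0 : ℝ)) (∑ _i ∈ s, 1) := by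
    filter_upwards [(Filter.eventually_all_finset s).2 fun i _ => h01 i] with ω hω
    rw [Finset.sum_apply]
    exact ⟨Finset.sum_le_sum fun i hi => (hω i hi).1, Finset.sum_le_sum fun i hi => (hω i hi).2⟩
  have hint : Integrable (fun ω => Real.exp (-l * (∑ i ∈ s, X i) ω)) P :=
    integrable_exp_mul_of_mem_Icc (s.aemeasurable_sum fun i _ => hX i) hsum
  have chernoff := measure_le_le_exp_mul_mgf c (neg_nonpos.2 hl) hint
  simp only [Finset.sum_apply, neg_neg, hind.mgf_sum₀ hX] at chernoff
  rw [Real.exp_add, Finset.sum_mul, Real.exp_sum]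
  refine chernoff.trans ?_
  gcongr with i
  · exact fun i _ => mgf_nonneg
  · exact mgf_le_exp_integral_mul (hX i) (h01 i) _

end Chernoff

section BennettH

variable {v ε : ℝ}

lemma sq_div_two_le_bennettH_neg {t : ℝ} (h0 : 0 ≤ t) (h1 : t ≤ 1) :
    t ^ 2 / 2 ≤ bennettH (-t) := by
  unfold bennettH
  rcases h1.eq_or_lt with rfl | h1
  · norm_num
  have hu : 0 < 1 + -t := by linarith
  have hlog : Real.log (1 + -t) ≤ 0 := Real.log_nonpos hu.le (by linarith)
  -- `log u ≥ (u - u⁻¹) / 2` for `u ≤ 1`, from `y ≤ sinh y` at `y = -log u`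
  have hsinh := Real.self_le_sinh_iff.2 (neg_nonneg.2 hlog)
  rw [Real.sinh_neg, Real.sinh_log hu, neg_le_neg_iff] at hsinh
  calc t ^ 2 / 2 = (1 + -t) * (((1 + -t) - (1 + -t)⁻¹) / 2) - -t := by
        field_simp
        ring
    _ ≤ (1 + -t) * Real.log (1 + -t) - -t := by gcongr

lemma exp_neg_mul_bennettH_neg_div_le {c d : ℝ} (hc : 0 ≤ c) (hd : 0 ≤ d) (hv : 0 < v)
    (hε : 0 ≤ ε) (hεv : ε ≤ v) :
    Real.exp (-(c * v / d * bennettH (-(ε / v)))) ≤ Real.exp (-(c * ε ^ 2 / (2 * d * v))) := by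
  gcongr
  calc c * ε ^ 2 / (2 * d * v) = c * v / d * ((ε / v) ^ 2 / 2) := by field_simp
    _ ≤ c * v / d * bennettH (-(ε / v)) := by
        gcongr
        exact sq_div_two_le_bennettH_neg (by positivity) ((div_le_one hv).2 hεv)

lemma le_exp_neg_mul_bennettH_of_forall_le_exp (hv : 0 < v) (hε : 0 ≤ ε) (hεv : ε ≤ v) {p : ℝ}
    (h : ∀ l, 0 ≤ l → p ≤ Real.exp (l * (v - ε) + v * (Real.exp (-l) - 1))) :
    p ≤ Real.exp (-(v * bennettH (-(ε / v)))) := by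
  rcases hεv.eq_or_lt with rfl | hlt
  · -- the optimal parameter `-log (1 - ε / v)` is infinite here
    have hlim : Filter.Tendsto (fun l => Real.exp (ε * (Real.exp (-l) - 1))) Filter.atTop
        (nhds (Real.exp (ε * (0 - 1)))) :=
      (Real.continuous_exp.tendsto _).comp
        ((Real.tendsto_exp_neg_atTop_nhds_zero.sub_const 1).const_mul ε)
    have hp : p ≤ Real.exp (ε * (0 - 1)) :=
      ge_of_tendsto hlim <| (Filter.eventually_ge_atTop 0).mono fun l hl => by simpa using h l hl
    simpa [bennettH, div_self hv.ne'] using hp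
  · have hu : 0 < 1 + -(ε / v) := by linarith [(div_lt_one hv).2 hlt]
    have hlog : Real.log (1 + -(ε / v)) ≤ 0 :=
      Real.log_nonpos hu.le (by linarith [div_nonneg hε hv.le])
    refine (h _ (neg_nonneg.2 hlog)).trans_eq ?_
    rw [neg_neg, Real.exp_log hu, bennettH]
    congr 1
    field_simp
    ring

end BennettH

section SupremumOfSums

variable {κ ι 𝓧 Ω : Type*} [Fintype ι]

lemma bddAbove_range_sum_of_forall_le {u : κ → ι → ℝ} {b : ι → ℝ} (hu : ∀ k i, u k i ≤ b i) :
    BddAbove (Set.range fun k => ∑ i, u k i) :=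
  ⟨∑ i, b i, Set.forall_mem_range.2 fun k => Finset.sum_le_sum fun i _ => hu k i⟩

lemma isSelfBounding_iSup_sum {n : ℕ} {φ : κ → 𝓧 → ℝ} (h01 : ∀ k x, φ k x ∈ Set.Icc (0 : ℝ) 1) :
    IsSelfBounding 1 0 (fun s : Fin n → 𝓧 => ⨆ k, ∑ i, φ k (s i)) := by
  have hnonneg {α : Type} [Fintype α] (s : α → 𝓧) : 0 ≤ ⨆ k, ∑ i, φ k (s i) :=
    Real.iSup_nonneg fun k => Finset.sum_nonneg fun i _ => (h01 k _).1
  have hle {α : Type} [Fintype α] (s : α → 𝓧) (k : κ) :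
      ∑ i, φ k (s i) ≤ ⨆ k, ∑ i, φ k (s i) :=
    le_ciSup (bddAbove_range_sum_of_forall_le fun k i => (h01 k (s i)).2) k
  have hsplit (s : Fin n → 𝓧) (i : Fin n) (k : κ) :
      ∑ j, φ k (s j) = φ k (s i) + ∑ j : {j : Fin n // j ≠ i}, φ k (s j) :=
    Fintype.sum_eq_add_sum_subtype_ne (fun j => φ k (s j)) i
  refine ⟨hnonneg, fun i y => ⨆ k, ∑ j, φ k (y j), fun s => ⟨fun i => ⟨?_, ?_⟩, ?_⟩⟩
  · refine sub_nonneg.2 (Real.iSup_le (fun k => ?_) (hnonneg s))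
    linarith [hle s k, hsplit s i k, (h01 k (s i)).1]
  · refine sub_le_iff_le_add.2 (Real.iSup_le (fun k => ?_) (add_nonneg zero_le_one (hnonneg _)))
    linarith [hle (fun j : {j : Fin n // j ≠ i} => s j) k, hsplit s i k, (h01 k (s i)).2]
  · suffices n * ⨆ k, ∑ i, φ k (s i) ≤
        (⨆ k, ∑ i, φ k (s i)) + ∑ i, ⨆ k, ∑ j : {j : Fin n // j ≠ i}, φ k (s j) by
      simp only [Finset.sum_sub_distrib, Finset.sum_const, Finset.card_univ, Fintype.card_fin,
        nsmul_eq_mul]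
      linarith
    rw [Real.mul_iSup_of_nonneg n.cast_nonneg]
    refine Real.iSup_le (fun k => ?_)
      (add_nonneg (hnonneg s) (Finset.sum_nonneg fun i _ => hnonneg _))
    calc n * ∑ i, φ k (s i) = ∑ i, (φ k (s i) + ∑ j : {j : Fin n // j ≠ i}, φ k (s j)) := by
          simp [← hsplit s]
      _ = ∑ i, φ k (s i) + ∑ i, ∑ j : {j : Fin n // j ≠ i}, φ k (s j) := Finset.sum_add_distrib
      _ ≤ (⨆ k, ∑ i, φ k (s i)) + ∑ i, ⨆ k, ∑ j : {j : Fin n // j ≠ i}, φ k (s j) := by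
          gcongr with i
          · exact hle s k
          · exact hle (fun j : {j : Fin n // j ≠ i} => s j) k

variable [MeasurableSpace Ω] {P : Measure Ω}

lemma ciSup_integral_le_integral_ciSup [Nonempty κ] {X : κ → Ω → ℝ}
    (hbdd : ∀ ω, BddAbove (Set.range fun k => X k ω)) (hX : ∀ k, Integrable (X k) P)
    (hsup : Integrable (fun ω => ⨆ k, X k ω) P) :
    ⨆ k, ∫ ω, X k ω ∂P ≤ ∫ ω, ⨆ k, X k ω ∂P :=
  ciSup_le fun k => integral_mono (hX k) hsup fun ω => le_ciSup (hbdd ω) k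

variable [IsProbabilityMeasure P] [Nonempty κ] {Y : κ → ι → Ω → ℝ}

lemma measureReal_iSup_sum_le_le_exp (hY : ∀ k i, AEMeasurable (Y k i) P)
    (h01 : ∀ k i ω, Y k i ω ∈ Set.Icc (0 : ℝ) 1) (hind : ∀ k, iIndepFun (Y k) P)
    (c : ℝ) {l : ℝ} (hl : 0 ≤ l) :
    P.real {ω | ⨆ k, ∑ i, Y k i ω ≤ c} ≤
      Real.exp (l * c + (⨆ k, ∑ i, ∫ ω, Y k i ω ∂P) * (Real.exp (-l) - 1)) := by
  have hmean (k : κ) (i : ι) : ∫ ω, Y k i ω ∂P ∈ Set.Icc (0 : ℝ) 1 :=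
    (convex_Icc 0 1).integral_mem isClosed_Icc (.of_forall (h01 k i))
      (.of_mem_Icc 0 1 (hY k i) (.of_forall (h01 k i)))
  have hanti : Antitone fun v : ℝ => Real.exp (l * c + v * (Real.exp (-l) - 1)) := by
    have : Real.exp (-l) - 1 ≤ 0 := by simpa using hl
    intro v w hvw
    exact Real.exp_le_exp.2 (by nlinarith)
  rw [hanti.map_ciSup_of_continuousAt (by fun_prop)
    (bddAbove_range_sum_of_forall_le fun k i => (hmean k i).2)]
  refine le_ciInf fun k => (measureReal_mono fun ω hω => ?_).trans
    (measureReal_sum_le_le_exp (hY k) (fun i => .of_forall (h01 k i)) (hind k) Finset.univ c hl)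
  exact (le_ciSup (bddAbove_range_sum_of_forall_le fun k i => (h01 k i ω).2) k).trans hω

lemma measureReal_iSup_sum_add_le_le_exp_bennettH (hY : ∀ k i, AEMeasurable (Y k i) P)
    (h01 : ∀ k i ω, Y k i ω ∈ Set.Icc (0 : ℝ) 1) (hind : ∀ k, iIndepFun (Y k) P)
    {v ε : ℝ} (hv : ⨆ k, ∑ i, ∫ ω, Y k i ω ∂P = v) (hv0 : 0 < v) (hε : 0 ≤ ε) (hεv : ε ≤ v) :
    P.real {ω | (⨆ k, ∑ i, Y k i ω) + ε ≤ v} ≤ Real.exp (-(v * bennettH (-(ε / v)))) := by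
  simp only [← le_sub_iff_add_le]
  refine le_exp_neg_mul_bennettH_of_forall_le_exp hv0 hε hεv fun l hl => ?_
  simpa only [hv] using measureReal_iSup_sum_le_le_exp hY h01 hind (v - ε) hl

end SupremumOfSums

section ConfidenceBound

lemma le_add_sqrt_of_lt_add_sqrt {v u A : ℝ} (hA : 0 ≤ A) (h : v < u + √(2 * A * v)) :
    v ≤ u + A + √(A ^ 2 + 2 * A * u) := by
  by_contra! hgt
  have hsqrt : √(A ^ 2 + 2 * A * u) < v - u - A := by linarith
  rw [Real.sqrt_lt' (by linarith [Real.sqrt_nonneg (A ^ 2 + 2 * A * u)])] at hsqrt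
  have hlt : v - u < √(2 * A * v) := by linarith
  rw [Real.lt_sqrt (by linarith [Real.sqrt_nonneg (A ^ 2 + 2 * A * u)])] at hlt
  nlinarith

lemma one_sub_le_measureReal_le_add_sqrt {Ω : Type*} [MeasurableSpace Ω] {P : Measure Ω}
    [IsProbabilityMeasure P] {U : Ω → ℝ} (hU : ∀ ω, 0 ≤ U ω) {v A δ : ℝ} (hA : 0 ≤ A) (hδ : 0 ≤ δ)
    (htail : 2 * A < v → P.real {ω | U ω + √(2 * A * v) ≤ v} ≤ δ) :
    1 - δ ≤ P.real {ω | v ≤ U ω + A + √(A ^ 2 + 2 * A * U ω)} := by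
  rcases le_or_gt v (2 * A) with hsmall | hlarge
  · have huniv : {ω | v ≤ U ω + A + √(A ^ 2 + 2 * A * U ω)} = Set.univ := by
      refine Set.eq_univ_of_forall fun ω => ?_
      have hsqrt : A ≤ √(A ^ 2 + 2 * A * U ω) :=
        Real.le_sqrt_of_sq_le (le_add_of_nonneg_right (mul_nonneg (by positivity) (hU ω)))
      exact hsmall.trans (by linarith [hU ω])
    rw [huniv, probReal_univ]
    linarith
  · have hcover : (Set.univ : Set Ω) ⊆ {ω | v ≤ U ω + A + √(A ^ 2 + 2 * A * U ω)} ∪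
        {ω | U ω + √(2 * A * v) ≤ v} := fun ω _ =>
      (lt_or_ge v (U ω + √(2 * A * v))).imp_left (le_add_sqrt_of_lt_add_sqrt hA)
    have hsum := (measureReal_mono (μ := P) hcover).trans (measureReal_union_le _ _)
    rw [probReal_univ] at hsum
    linarith [htail hlarge]

end ConfidenceBound

section WimpyVariance

variable {𝓧 Ω : Type*} {F : Set (𝓧 → ℝ)} {c z : ℝ} {m : ℕ}

lemma sq_div_sq_mem_Icc {x : ℝ} (hx : |x| ≤ z) : x ^ 2 / z ^ 2 ∈ Set.Icc (0 : ℝ) 1 :=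
  ⟨by positivity, div_le_one_of_le₀ (sq_le_sq.2 (hx.trans (le_abs_self z))) (sq_nonneg z)⟩

lemma empWimpyVariance_nonneg (s : Fin m → 𝓧) : 0 ≤ empWimpyVariance F s :=
  mul_nonneg (by positivity)
    (Real.iSup_nonneg fun _ => Finset.sum_nonneg fun _ _ => sq_nonneg _)

lemma empWimpyVariance_le (hFz : ∀ f ∈ F, ∀ x, |f x| ≤ z) (s : Fin m → 𝓧) :
    empWimpyVariance F s ≤ z ^ 2 := by
  rw [empWimpyVariance, one_div]
  refine inv_mul_le_of_le_mul₀ m.cast_nonneg (sq_nonneg z)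
    (Real.iSup_le (fun f => ?_) (by positivity))
  calc ∑ i, f.1 (s i) ^ 2 ≤ ∑ _i : Fin m, z ^ 2 :=
        Finset.sum_le_sum fun i _ => sq_le_sq.2 ((hFz f f.2 _).trans (le_abs_self z))
    _ = m * z ^ 2 := by simp

lemma mul_empWimpyVariance_div (hc : 0 ≤ c) (s : Fin m → 𝓧) :
    m * empWimpyVariance F s / c = ⨆ f : F, ∑ i, f.1 (s i) ^ 2 / c := by
  rcases m.eq_zero_or_pos with rfl | hm
  · simp [empWimpyVariance]
  · rw [empWimpyVariance, ← mul_assoc, mul_one_div_cancel (by positivity), one_mul, div_eq_mul_inv,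
      Real.iSup_mul_of_nonneg (inv_nonneg.2 hc)]
    simp only [← div_eq_mul_inv, Finset.sum_div]

lemma isSelfBounding_empWimpyVariance (hFz : ∀ f ∈ F, ∀ x, |f x| ≤ z) :
    IsSelfBounding 1 0 (fun s : Fin m → 𝓧 => m * empWimpyVariance F s / z ^ 2) := by
  simp only [mul_empWimpyVariance_div (sq_nonneg z)]
  exact isSelfBounding_iSup_sum fun (f : F) x => sq_div_sq_mem_Icc (hFz f f.2 x)

variable [MeasurableSpace Ω] {P : Measure Ω} {S : Fin m → Ω → 𝓧}

lemma integrable_empWimpyVariance [IsFiniteMeasure P] (hFz : ∀ f ∈ F, ∀ x, |f x| ≤ z)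
    (hmeas : AEMeasurable (fun ω => empWimpyVariance F (fun i => S i ω)) P) :
    Integrable (fun ω => empWimpyVariance F (fun i => S i ω)) P :=
  .of_mem_Icc 0 (z ^ 2) hmeas (.of_forall fun _ =>
    ⟨empWimpyVariance_nonneg _, empWimpyVariance_le hFz _⟩)

variable [MeasurableSpace 𝓧] {μ : Measure 𝓧}

lemma iSup_sum_integral_sq_div (hF : ∀ f ∈ F, AEMeasurable f μ) (hS : ∀ i, HasLaw (S i) μ P)
    (hc : 0 ≤ c) :
    ⨆ f : F, ∑ i, ∫ ω, f.1 (S i ω) ^ 2 / c ∂P = m * wimpyVariance F μ / c := by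
  have hmean (f : F) (i : Fin m) :
      ∫ ω, f.1 (S i ω) ^ 2 / c ∂P = (∫ x, f.1 x ^ 2 ∂μ) / c := by
    rw [integral_div]
    exact congrArg (· / c) ((hS i).integral_comp ((hF f f.2).pow_const 2).aestronglyMeasurable)
  simp only [hmean, Finset.sum_const, Finset.card_univ, Fintype.card_fin, nsmul_eq_mul]
  rw [wimpyVariance, mul_div_right_comm, Real.mul_iSup_of_nonneg (by positivity)]
  simp only [mul_div_right_comm, mul_div_assoc']

lemma aemeasurable_sq_div_comp (hF : ∀ f ∈ F, AEMeasurable f μ) (hS : ∀ i, HasLaw (S i) μ P)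
    (f : F) (i : Fin m) : AEMeasurable (fun ω => f.1 (S i ω) ^ 2 / c) P :=
  ((((hS i).map_eq ▸ hF f f.2).comp_aemeasurable (hS i).aemeasurable).pow_const 2).div_const c

variable [IsProbabilityMeasure P]

lemma wimpyVariance_le_integral_empWimpyVariance (hm : 0 < m) (hz : 0 < z) (hne : F.Nonempty)
    (hF : ∀ f ∈ F, AEMeasurable f μ) (hFz : ∀ f ∈ F, ∀ x, |f x| ≤ z)
    (hS : ∀ i, HasLaw (S i) μ P)
    (hmeas : AEMeasurable (fun ω => empWimpyVariance F (fun i => S i ω)) P) :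
    wimpyVariance F μ ≤ ∫ ω, empWimpyVariance F (fun i => S i ω) ∂P := by
  have : Nonempty F := hne.to_subtype
  have h01 (f : F) (i : Fin m) (ω : Ω) := sq_div_sq_mem_Icc (hFz f f.2 (S i ω))
  have hint (f : F) (i : Fin m) : Integrable (fun ω => f.1 (S i ω) ^ 2 / z ^ 2) P :=
    .of_mem_Icc 0 1 (aemeasurable_sq_div_comp hF hS f i) (.of_forall (h01 f i))
  have hle := ciSup_integral_le_integral_ciSup
    (fun ω => bddAbove_range_sum_of_forall_le fun f i => (h01 f i ω).2)
    (fun f => integrable_finsetSum Finset.univ fun i _ => hint f i)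
    (by simpa only [← mul_empWimpyVariance_div (sq_nonneg z)] using
      ((integrable_empWimpyVariance hFz hmeas).const_mul (m : ℝ)).div_const (z ^ 2))
  simp only [integral_finsetSum Finset.univ fun i _ => hint _ i,
    ← mul_empWimpyVariance_div (sq_nonneg z)] at hle
  rw [iSup_sum_integral_sq_div hF hS (sq_nonneg z), integral_div, integral_const_mul] at hle
  rwa [div_le_div_iff_of_pos_right (by positivity), mul_le_mul_iff_right₀ (by positivity)] at hle

lemma measureReal_empWimpyVariance_add_le_wimpyVariance_le (hm : 0 < m) (hz : 0 < z)
    (hne : F.Nonempty) (hF : ∀ f ∈ F, AEMeasurable f μ) (hFz : ∀ f ∈ F, ∀ x, |f x| ≤ z)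
    (hS : ∀ i, HasLaw (S i) μ P) (hind : iIndepFun S P) (hv : 0 < wimpyVariance F μ)
    {ε : ℝ} (hε : 0 ≤ ε) (hεv : ε ≤ wimpyVariance F μ) :
    P.real {ω | empWimpyVariance F (fun i => S i ω) + ε ≤ wimpyVariance F μ} ≤
      Real.exp (-(m * wimpyVariance F μ / z ^ 2 * bennettH (-(ε / wimpyVariance F μ)))) := by
  have : Nonempty F := hne.to_subtype
  have hindsq (f : F) : iIndepFun (fun i ω => f.1 (S i ω) ^ 2 / z ^ 2) P :=
    hind.comp₀ (fun _ x => f.1 x ^ 2 / z ^ 2) (fun i => (hS i).aemeasurable) fun i =>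
      (((hS i).map_eq ▸ hF f f.2).pow_const 2).div_const _
  have htail := measureReal_iSup_sum_add_le_le_exp_bennettH (ε := m * ε / z ^ 2)
    (aemeasurable_sq_div_comp hF hS) (fun f i ω => sq_div_sq_mem_Icc (hFz f f.2 (S i ω))) hindsq
    (iSup_sum_integral_sq_div hF hS (sq_nonneg z)) (by positivity) (by positivity) (by gcongr)
  simp only [← mul_empWimpyVariance_div (sq_nonneg z)] at htail
  have hratio : m * ε / z ^ 2 / (m * wimpyVariance F μ / z ^ 2) = ε / wimpyVariance F μ := by
    field_simp
  rw [hratio] at htail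
  refine (measureReal_mono fun ω hω => ?_).trans htail
  rw [Set.mem_ofPred_eq, ← add_div, ← mul_add]
  gcongr
  exact hω

lemma one_sub_le_measureReal_wimpyVariance_le (hm : 0 < m) (hz : 0 < z)
    (hne : F.Nonempty) (hF : ∀ f ∈ F, AEMeasurable f μ) (hFz : ∀ f ∈ F, ∀ x, |f x| ≤ z)
    (hS : ∀ i, HasLaw (S i) μ P) (hind : iIndepFun S P) {δ : ℝ} (hδ : 0 < δ) (hδ1 : δ ≤ 1) :
    1 - δ ≤ P.real {ω | wimpyVariance F μ ≤
      empWimpyVariance F (fun i => S i ω) + z ^ 2 * Real.log (1 / δ) / m +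
        √((z ^ 2 * Real.log (1 / δ) / m) ^ 2 +
          2 * z ^ 2 * empWimpyVariance F (fun i => S i ω) * Real.log (1 / δ) / m)} := by
  have hlog : 0 ≤ Real.log (1 / δ) := Real.log_nonneg (by rwa [one_le_div hδ])
  set A := z ^ 2 * Real.log (1 / δ) / m with hA
  have hA0 : 0 ≤ A := by positivity
  have hcross (u : ℝ) : 2 * z ^ 2 * u * Real.log (1 / δ) / m = 2 * A * u := by rw [hA]; ring
  simp only [hcross]
  refine one_sub_le_measureReal_le_add_sqrt (fun ω => empWimpyVariance_nonneg _) hA0 hδ.le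
    fun hlarge => ?_
  have hv : 0 < wimpyVariance F μ := by linarith
  have hεv : √(2 * A * wimpyVariance F μ) ≤ wimpyVariance F μ :=
    Real.sqrt_le_iff.2 ⟨hv.le, by nlinarith⟩
  -- `ε = √(2 A σ²)` is the deviation at which the quadratic tail bound equals `δ`
  have hexponent : m * √(2 * A * wimpyVariance F μ) ^ 2 / (2 * z ^ 2 * wimpyVariance F μ) =
      Real.log (1 / δ) := by
    rw [Real.sq_sqrt (by positivity), hA]
    field_simp
  calc P.real {ω | empWimpyVariance F (fun i => S i ω) + √(2 * A * wimpyVariance F μ) ≤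
        wimpyVariance F μ}
      ≤ Real.exp (-(m * √(2 * A * wimpyVariance F μ) ^ 2 / (2 * z ^ 2 * wimpyVariance F μ))) :=
        (measureReal_empWimpyVariance_add_le_wimpyVariance_le hm hz hne hF hFz hS hind hv
          (Real.sqrt_nonneg _) hεv).trans
          (exp_neg_mul_bennettH_neg_div_le m.cast_nonneg (sq_nonneg z) hv (Real.sqrt_nonneg _) hεv)
    _ = δ := by rw [hexponent, one_div, Real.log_inv, neg_neg, Real.exp_log hδ]

end WimpyVariance

theorem mainTheorem5 {𝓧 Ω : Type*} [MeasurableSpace 𝓧] [MeasurableSpace Ω]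
    (P : Measure Ω) [IsProbabilityMeasure P]
    (μ : Measure 𝓧) [IsProbabilityMeasure μ]
    (a b z : ℝ) (ha : a ≤ 0) (hb : 0 < b) (hz : z = max |a| |b|)
    (F : Set (𝓧 → ℝ)) (hF : F.Nonempty)
    (hFmeas : ∀ f ∈ F, Measurable f)
    (hFab : ∀ f ∈ F, ∀ x, f x ∈ Set.Icc a b)
    (m : ℕ) (hm : 0 < m) (S : Fin m → Ω → 𝓧)
    (hSmeas : ∀ i, Measurable (S i))
    (hSindep : iIndepFun S P)
    (hSlaw : ∀ i, P.map (S i) = μ)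
    (hmeas : AEMeasurable (fun ω => empWimpyVariance F (fun i => S i ω)) P) :
    IsSelfBounding 1 0 (fun s : Fin m → 𝓧 => (m : ℝ) * empWimpyVariance F s / z ^ 2) ∧
    (Integrable (fun ω => empWimpyVariance F (fun i => S i ω)) P ∧
      wimpyVariance F μ ≤ ∫ ω, empWimpyVariance F (fun i => S i ω) ∂P) ∧
    (0 < wimpyVariance F μ → ∀ ε : ℝ, 0 ≤ ε → ε ≤ wimpyVariance F μ →
      P.real {ω | wimpyVariance F μ ≥ empWimpyVariance F (fun i => S i ω) + ε} ≤
          Real.exp (-((m : ℝ) * wimpyVariance F μ / z ^ 2 *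
            bennettH (-(ε / wimpyVariance F μ)))) ∧
      Real.exp (-((m : ℝ) * wimpyVariance F μ / z ^ 2 *
            bennettH (-(ε / wimpyVariance F μ)))) ≤
          Real.exp (-((m : ℝ) * ε ^ 2 / (2 * z ^ 2 * wimpyVariance F μ)))) ∧
    (∀ δ : ℝ, 0 < δ → δ ≤ 1 →
      1 - δ ≤ P.real {ω | wimpyVariance F μ ≤
        empWimpyVariance F (fun i => S i ω) + z ^ 2 * Real.log (1 / δ) / m +
          Real.sqrt ((z ^ 2 * Real.log (1 / δ) / m) ^ 2 +
            2 * z ^ 2 * empWimpyVariance F (fun i => S i ω) * Real.log (1 / δ) / m)}) := by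
  have hzpos : 0 < z := hz ▸ lt_max_of_lt_right (abs_pos.2 hb.ne')
  have hFz : ∀ f ∈ F, ∀ x, |f x| ≤ z := fun f hf x =>
    hz ▸ abs_le_max_abs_abs (hFab f hf x).1 (hFab f hf x).2
  have hFaem : ∀ f ∈ F, AEMeasurable f μ := fun f hf => (hFmeas f hf).aemeasurable
  have hS : ∀ i, HasLaw (S i) μ P := fun i => ⟨(hSmeas i).aemeasurable, hSlaw i⟩
  refine ⟨isSelfBounding_empWimpyVariance hFz,
    ⟨integrable_empWimpyVariance hFz hmeas,
      wimpyVariance_le_integral_empWimpyVariance hm hzpos hF hFaem hFz hS hmeas⟩,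
    fun hv ε hε hεv => ⟨?_, ?_⟩, fun δ hδ hδ1 => ?_⟩
  · exact measureReal_empWimpyVariance_add_le_wimpyVariance_le
      hm hzpos hF hFaem hFz hS hSindep hv hε hεv
  · exact exp_neg_mul_bennettH_neg_div_le m.cast_nonneg (sq_nonneg z) hv hε hεv
  · exact one_sub_le_measureReal_wimpyVariance_le hm hzpos hF hFaem hFz hS hSindep hδ hδ1
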